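/- Let $S$ be a finite or countable set and let $A=(a(x,y))_{x,y\in S}$ be a conservative $Q$-matrix with finite negative diagonal entries, i.e. $a(x,y)\ge 0$ for $x\ne y$, $a(x,x)<0$, and $\sum_{y\in S}a(x,y)=0$ for every $x\in S$. Let $\xi=\{\xi(t),\,t\ge 0\}$ be an irreducible continuous-time Markov chain on $S$ with $Q$-matrix $A$ and with right-continuous paths. Explosion is allowed: paths are taken in the one-point compactification $S\cup\{\infty\}$ of the discrete space $S$. Let $\mathbb P_x$ be the law of the chain started at $x$. For $x,y\in S$ and $H\subseteq S$ put $$\tau_x=\mathbb I\{\xi(0)=x\}\inf\{t\ge 0:\xi(t)\ne x\},$$ $${}_H\tau_{xy}=\mathbb I\{\xi(0)=x\}\inf\{t\ge\tau_x:\ \xi(t)=y,\ \xi(u)\notin H\text{ for }\tau_x<u<t\},\qquad \inf\varnothing=\infty,$$ and let ${}_HF_{xy}(\infty)=\mathbb P_x({}_H\tau_{xy}<\infty)$. Write ${}_{z,H}F_{xy}$ for ${}_{\{z\}\cup H}F_{xy}$, and $\delta_{xy}$ for the Kronecker delta. 1. If $H\subseteq S$ is nonempty, $x,y,z\in S$,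 $y,z\notin H$ and $z\ne y$, then ${}_HF_{yz}(\infty)\,{}_HF_{zy}(\infty)<1$ and $${}_{z,H}F_{xy}(\infty)=\frac{{}_HF_{xy}(\infty)-{}_HF_{xz}(\infty)\,{}_HF_{zy}(\infty)}{1-{}_HF_{yz}(\infty)\,{}_HF_{zy}(\infty)}.$$ 2. If $H\subseteq S$ is any set, $x,y\in S$, $x\notin H$ and $x\ne y$, then ${}_{y,H}F_{xx}(\infty)<1$ and $${}_HF_{xy}(\infty)=\frac{{}_{x,H}F_{xy}(\infty)}{1-{}_{y,H}F_{xx}(\infty)}.$$ 3. For any $H\subseteq S$ and $x,y\in S$, $${}_HF_{xy}(\infty)=(\delta_{xy}-1)\frac{a(x,y)}{a(x,x)}-\sum_{z\in S,\ z\ne x,\ z\ne y,\ z\notin H}\frac{a(x,z)}{a(x,x)}\,{}_HF_{zy}(\infty),$$ where the series converges absolutely. -/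

import Mathlib

open Set Filter Topology MeasureTheory
open scoped NNReal ENNReal

namespace TabooChain

/-- A conservative `Q`-matrix on `S` with (finite and) negative diagonal entries. -/
structure IsConservativeQMatrix {S : Type*} (A : Matrix S S ℝ) : Prop where
  nonneg : ∀ x y, x ≠ y → 0 ≤ A x y
  diag_neg : ∀ x, A x x < 0
  row_sum : ∀ x, HasSum (fun y => A x y) 0

/-- The σ-algebra generated by the process up to time `s`. -/
@[reducible] def past {S Ω : Type*} (ξ : ℝ≥0 → Ω → OnePoint S) (s : ℝ≥0) : MeasurableSpace Ω :=
  ⨆ u : {u : ℝ≥0 // u ≤ s}, MeasurableSpace.comap (ξ u) ⊤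

/-- The transition function `p t x y = P_x (ξ t = y)`. -/
noncomputable def transProb {S Ω : Type*} [MeasurableSpace Ω] (P : S → Measure Ω)
    (ξ : ℝ≥0 → Ω → OnePoint S) (t : ℝ≥0) (x y : S) : ℝ :=
  (P x).real {ω | ξ t ω = (y : OnePoint S)}

/-- `ξ` under the laws `P x` (`x` the starting state) is a continuous-time homogeneous Markov
chain on the discrete state space `S` with `Q`-matrix `A`.
The paths are right-continuous in the one-point compactification of `S`. The ideal
point `∞` is not a state: it only serves to allow for explosion (with or without a return to `S`).
If the path does not take the value `∞`, this is right-continuity of a path in `S`. -/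
structure IsMarkovChain {S Ω : Type*} [TopologicalSpace S] [MeasurableSpace Ω]
    (A : Matrix S S ℝ) (P : S → Measure Ω) (ξ : ℝ≥0 → Ω → OnePoint S) : Prop where
  prob : ∀ x, IsProbabilityMeasure (P x)
  meas : ∀ t, @Measurable Ω (OnePoint S) ‹MeasurableSpace Ω› ⊤ (ξ t)
  right_cont : ∀ ω t, ContinuousWithinAt (fun u => ξ u ω) (Ici t) t
  start : ∀ x : S, ∀ᵐ ω ∂(P x), ξ 0 ω = (x : OnePoint S)
  markov : ∀ (x : S) (s t : ℝ≥0) (y z : S) (B : Set Ω), MeasurableSet[past ξ s] B →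
    P x (B ∩ {ω | ξ s ω = (y : OnePoint S)} ∩ {ω | ξ (s + t) ω = (z : OnePoint S)}) =
      P x (B ∩ {ω | ξ s ω = (y : OnePoint S)}) * P y {ω | ξ t ω = (z : OnePoint S)}
  chapman_kolmogorov : ∀ (s t : ℝ≥0) (x z : S),
    HasSum (fun y => transProb P ξ s x y * transProb P ξ t y z) (transProb P ξ (s + t) x z)
  generator : ∀ x y : S,
    Tendsto (fun t : ℝ≥0 => (transProb P ξ t x y - transProb P ξ 0 x y) / (t : ℝ))
      (𝓝[>] 0) (𝓝 (A x y))

/-- Irreducibility: every state can be reached from every state. -/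
def IsIrreducible {S Ω : Type*} [MeasurableSpace Ω] (P : S → Measure Ω)
    (ξ : ℝ≥0 → Ω → OnePoint S) : Prop :=
  ∀ x y : S, ∃ t : ℝ≥0, 0 < t ∧ 0 < transProb P ξ t x y

/-- The first exit time `τ_x = 𝟙{ξ 0 = x} inf {t ≥ 0 : ξ t ≠ x}` (with `inf ∅ = ∞`). -/
noncomputable def exitTime {S Ω : Type*} (ξ : ℝ≥0 → Ω → OnePoint S) (x : S) : Ω → ℝ≥0∞ :=
  Set.indicator {ω | ξ 0 ω = (x : OnePoint S)} fun ω =>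
    sInf {r : ℝ≥0∞ | ∃ t : ℝ≥0, r = t ∧ ξ t ω ≠ (x : OnePoint S)}

/-- The first entrance (if `x = y`: return) time from `x` to `y` under taboo `H`,
`𝟙{ξ 0 = x} inf {t ≥ τ_x : ξ t = y, ξ u ∉ H for τ_x < u < t}` (with `inf ∅ = ∞`). -/
noncomputable def hitTime {S Ω : Type*} (ξ : ℝ≥0 → Ω → OnePoint S) (H : Set S) (x y : S) :
    Ω → ℝ≥0∞ :=
  Set.indicator {ω | ξ 0 ω = (x : OnePoint S)} fun ω =>
    sInf {r : ℝ≥0∞ | ∃ t : ℝ≥0, r = t ∧ exitTime ξ x ω ≤ t ∧ ξ t ω = (y : OnePoint S) ∧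
      ∀ u : ℝ≥0, exitTime ξ x ω < u → u < t → ∀ h ∈ H, ξ u ω ≠ (h : OnePoint S)}

/-- The (improper) distribution function of the hitting time under taboo. -/
noncomputable def hitCDF {S Ω : Type*} [MeasurableSpace Ω] (P : S → Measure Ω)
    (ξ : ℝ≥0 → Ω → OnePoint S) (H : Set S) (x y : S) (t : ℝ≥0) : ℝ :=
  (P x).real {ω | hitTime ξ H x y ω ≤ t}

/-- Its value at infinity: the probability, starting from `x`, that the hitting time of `y`
under taboo `H` is finite. -/
noncomputable def hitProb {S Ω : Type*} [MeasurableSpace Ω] (P : S → Measure Ω)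
    (ξ : ℝ≥0 → Ω → OnePoint S) (H : Set S) (x y : S) : ℝ :=
  (P x).real {ω | hitTime ξ H x y ω < ⊤}

/-- `hitProb` is the limit at infinity of the distribution function `hitCDF`. -/
theorem tendsto_hitCDF {S Ω : Type*} [MeasurableSpace Ω] (P : S → Measure Ω)
    (hP : ∀ x, IsProbabilityMeasure (P x)) (ξ : ℝ≥0 → Ω → OnePoint S) (H : Set S) (x y : S) :
    Tendsto (hitCDF P ξ H x y) atTop (𝓝 (hitProb P ξ H x y)) := by
  have := hP x
  have hmono : Monotone (fun t : ℝ≥0 => {ω | hitTime ξ H x y ω ≤ t}) := by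
    intro s t hst ω hω
    exact le_trans hω (ENNReal.coe_le_coe.2 hst)
  have hU : (⋃ t : ℝ≥0, {ω | hitTime ξ H x y ω ≤ t}) = {ω | hitTime ξ H x y ω < ⊤} := by
    ext ω
    simp only [mem_iUnion, mem_ofPred_eq]
    constructor
    · rintro ⟨t, ht⟩
      exact lt_of_le_of_lt ht ENNReal.coe_lt_top
    · intro h
      exact ⟨(hitTime ξ H x y ω).toNNReal, (ENNReal.coe_toNNReal h.ne).ge⟩
  have h := tendsto_measure_iUnion_atTop (μ := P x) hmono
  rw [hU] at h
  exact (ENNReal.tendsto_toReal (measure_ne_top _ _)).comp h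

end TabooChain

/-! Write F_H(x,y) for the hitting probability under taboo H. Two decompositions carry the theorem.
Splitting at the first visit to z, where z ∉ H and z ≠ y, gives F_H(x,y) = F_{z,H}(x,y) +
F_{y,H}(x,z) F_H(z,y) (`hitProb_decomp`). Splitting at the state entered on leaving x gives a series
(`hasSum_hitProb`). Formula 1 solves the linear system formed by the first decomposition and its
copy with y and z interchanged, formula 2 is the case z = x, and formula 3 is the second
decomposition.

No strong Markov property is used: the chain is sampled on grids whose mesh tends to 0. The sampled
process is a discrete-time chain (`isGridChain`), where each decomposition is a sum over
deterministic indices. By right-continuity, for each path the grid event agrees with the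
continuous-time event once the mesh is fine, so the probabilities converge (`tendsto_avoidHit`).
One-step grid probabilities converge to jump probabilities by the generator (`tendsto_jump`).

The denominators are positive because P_x(ξ(t) = y) ≤ t(-a(x,x)) F_{x}(x,y) (`transProb_le`).
Irreducibility thus makes F_{x}(x,y) positive, which keeps the return probability under taboo below
1. -/

namespace TabooChain

/-! ### Discrete-time chains: exit, first visit and last visit. -/

section PathSpace

/-- The discrete σ-algebra on the one-point compactification of a countable discrete space. -/
@[reducible] def discreteMeasurableSpace (S : Type*) : MeasurableSpace (OnePoint S) := ⊤

attribute [local instance] discreteMeasurableSpace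

instance countable_onePoint {S : Type*} [Countable S] : Countable (OnePoint S) :=
  inferInstanceAs (Countable (Option S))

variable {S Ω : Type*}

/-- The time shift on sequences. -/
def shift (k : ℕ) (X : ℕ → OnePoint S) : ℕ → OnePoint S := fun i => X (k + i)

/-- Sequences which visit `y`, without a visit to `H` before. -/
def avoidHit (H : Set S) (y : S) : Set (ℕ → OnePoint S) :=
  {X | ∃ k, X k = y ∧ ∀ j < k, ∀ h ∈ H, X j ≠ (h : OnePoint S)}

/-- Sequences which leave `x`, and whose continuation from the exit time on lies in `C`. -/
def exitSet (x : S) (C : Set (ℕ → OnePoint S)) : Set (ℕ → OnePoint S) :=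
  {X | ∃ m, (∀ j < m, X j = x) ∧ X m ≠ x ∧ shift m X ∈ C}

/-- The laws of a discrete-time Markov chain on `S`, the Markov property being required
at the states of `S` only. -/
structure IsGridChain (μ : S → Measure (ℕ → OnePoint S)) : Prop where
  prob : ∀ x, IsProbabilityMeasure (μ x)
  start : ∀ x : S, ∀ᵐ X ∂(μ x), X 0 = (x : OnePoint S)
  markov : ∀ (x z : S) (k : ℕ) (B C : Set (ℕ → OnePoint S)),
    (∀ X Y : ℕ → OnePoint S, (∀ j ≤ k, X j = Y j) → X ∈ B → Y ∈ B) → MeasurableSet C →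
    μ x (B ∩ {X | X k = z} ∩ shift k ⁻¹' C) = μ x (B ∩ {X | X k = z}) * μ z C

theorem shift_shift (j k : ℕ) (X : ℕ → OnePoint S) : shift j (shift k X) = shift (k + j) X := by
  ext i; simp [shift, add_assoc]

theorem measurable_shift (k : ℕ) : Measurable (shift (S := S) k) :=
  measurable_pi_lambda _ fun i => measurable_pi_apply (k + i)

theorem measurableSet_coord (k : ℕ) (A : Set (OnePoint S)) :
    MeasurableSet {X : ℕ → OnePoint S | X k ∈ A} :=
  measurable_pi_apply (X := fun _ : ℕ => OnePoint S) k (MeasurableSpace.measurableSet_top (s := A))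

theorem measurableSet_avoidHit (H : Set S) (y : S) : MeasurableSet (avoidHit H y) := by
  have : avoidHit H y = ⋃ k, ({X : ℕ → OnePoint S | X k ∈ ({(y : OnePoint S)} : Set _)} ∩
      ⋂ j, ⋂ _ : j < k, {X | X j ∈ {a : OnePoint S | ∀ h ∈ H, a ≠ (h : OnePoint S)}}) := by
    ext X; simp [avoidHit]
  rw [this]
  exact .iUnion fun k => (measurableSet_coord _ _).inter
    (.iInter fun j => .iInter fun _ => measurableSet_coord _ _)

theorem measurableSet_exitSet (x : S) {C : Set (ℕ → OnePoint S)} (hC : MeasurableSet C) :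
    MeasurableSet (exitSet x C) := by
  have : exitSet x C = ⋃ m, ((⋂ j, ⋂ _ : j < m, {X | X j ∈ ({(x : OnePoint S)} : Set _)}) ∩
      ({X | X m ∈ ({(x : OnePoint S)} : Set _)ᶜ} ∩ shift m ⁻¹' C)) := by
    ext X; simp [exitSet]
  rw [this]
  exact .iUnion fun k => .inter (.iInter fun j => .iInter fun _ => measurableSet_coord _ _)
    ((measurableSet_coord _ _).inter (measurable_shift k hC))

namespace IsGridChain

variable {μ : S → Measure (ℕ → OnePoint S)} (hμ : IsGridChain μ)
include hμ

theorem measure_congr_start (x : S) {C D : Set (ℕ → OnePoint S)}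
    (h : ∀ X : ℕ → OnePoint S, X 0 = x → (X ∈ C ↔ X ∈ D)) : μ x C = μ x D :=
  measure_congr <| by
    filter_upwards [hμ.start x] with X hX
    exact propext (h X hX)

theorem measure_stay (x : S) (e : ℕ) :
    μ x ({X | ∀ j < e, X j = x} ∩ {X | X e = x}) = μ x {X | X 1 = x} ^ e := by
  have := hμ.prob x
  induction e with
  | zero =>
    rw [pow_zero, ← measure_univ (μ := μ x)]
    exact hμ.measure_congr_start x fun X hX => by simp [hX]
  | succ e ih =>
    rw [pow_succ, ← ih, ← hμ.markov x x e {X | ∀ j < e, X j = x} {X | X 1 = x}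
      (fun X Y h hX j hj => by rw [← h j hj.le]; exact hX j hj) (measurableSet_coord 1 {(x : OnePoint S)})]
    congr 1
    ext X
    simp only [mem_inter_iff, mem_ofPred_eq, mem_preimage, shift, Nat.forall_lt_succ_right]

/-- Summing over the last index `e` before the exit gives a geometric series. In `ℝ≥0∞` this needs
no assumption that the chain can leave `x`. -/
theorem measure_exitSet (x : S) {C : Set (ℕ → OnePoint S)} (hC : MeasurableSet C) :
    μ x (exitSet x C) = (1 - μ x {X | X 1 = x})⁻¹ * μ x {X | X 1 ≠ x ∧ shift 1 X ∈ C} := by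
  set D : Set (ℕ → OnePoint S) := {X | X 1 ≠ x ∧ shift 1 X ∈ C}
  have hD : MeasurableSet D :=
    (measurableSet_coord 1 {(x : OnePoint S)}ᶜ).inter (measurable_shift 1 hC)
  have hdep : ∀ (e : ℕ) (X Y : ℕ → OnePoint S), (∀ j ≤ e, X j = Y j) →
      X ∈ {X : ℕ → OnePoint S | ∀ j < e, X j = x} → Y ∈ {X : ℕ → OnePoint S | ∀ j < e, X j = x} :=
    fun e X Y h hX j hj => by rw [← h j hj.le]; exact hX j hj
  have h1 : μ x (exitSet x C) =
      μ x (⋃ e, ({X | ∀ j < e, X j = x} ∩ {X | X e = x} ∩ shift e ⁻¹' D)) := by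
    refine hμ.measure_congr_start x fun X hX => ?_
    simp only [exitSet, mem_ofPred_eq, mem_iUnion, mem_inter_iff, mem_preimage, D, shift_shift]
    constructor
    · rintro ⟨_ | m, h, h', hs⟩
      · exact absurd hX h'
      · exact ⟨m, ⟨fun j hj => h j (by omega), h m (by omega)⟩, h', hs⟩
    · rintro ⟨m, ⟨h, h'⟩, h2, hs⟩
      exact ⟨m + 1, fun j hj => (Nat.lt_succ_iff_lt_or_eq.1 hj).elim (h j) fun e => e ▸ h', h2, hs⟩
  rw [h1, measure_iUnion]
  · simp_rw [hμ.markov x x _ _ D (hdep _) hD, hμ.measure_stay, ENNReal.tsum_mul_right,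
      ENNReal.tsum_geometric]
  · intro e e' hne
    rw [Function.onFun, Set.disjoint_left]
    rintro X ⟨⟨h1, h2⟩, h3, -⟩ ⟨⟨h1', h2'⟩, h3', -⟩
    rcases lt_or_gt_of_ne hne with h | h
    · rcases (Nat.succ_le_of_lt h).lt_or_eq with h | h
      · exact h3 (h1' _ h)
      · exact h3 (by subst h; exact h2')
    · rcases (Nat.succ_le_of_lt h).lt_or_eq with h | h
      · exact h3' (h1 _ h)
      · exact h3' (by subst h; exact h2)
  · intro e
    have : {X : ℕ → OnePoint S | ∀ j < e, X j = x} =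
        ⋂ j, ⋂ _ : j < e, {X | X j ∈ ({(x : OnePoint S)} : Set _)} := by ext; simp
    rw [this]
    exact ((MeasurableSet.iInter fun j => .iInter fun _ => measurableSet_coord _ _).inter
      (measurableSet_coord e {(x : OnePoint S)})).inter (measurable_shift e hD)

theorem measure_exitSet_state {x w : S} (hw : w ≠ x) {C : Set (ℕ → OnePoint S)}
    (hC : MeasurableSet C) :
    μ x (exitSet x ({X | X 0 = w} ∩ C)) =
      (1 - μ x {X | X 1 = x})⁻¹ * (μ x {X | X 1 = w} * μ w C) := by
  have h := hμ.markov x w 1 univ C (fun _ _ _ _ => trivial) hC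
  rw [univ_inter] at h
  have hm : MeasurableSet ({X : ℕ → OnePoint S | X 0 = w} ∩ C) :=
    .inter (measurableSet_coord 0 {(w : OnePoint S)}) hC
  rw [hμ.measure_exitSet x hm, ← h]
  congr 2
  ext X
  simp only [mem_inter_iff, mem_ofPred_eq, mem_preimage, shift, add_zero, and_iff_right_iff_imp]
  rintro ⟨h, -⟩ h'
  exact hw (OnePoint.coe_injective (h.symm.trans h'))

/-- Waiting at `z` neither hits `y` nor breaks the taboo, so counting from time 0 or from the exit
makes no difference. -/
theorem measure_avoidHit {z y : S} {H : Set S} (hzy : z ≠ y) (hz : z ∉ H) :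
    μ z (avoidHit H y) = μ z (exitSet z (avoidHit H y)) := by
  classical
  refine hμ.measure_congr_start z fun X hX => ⟨?_, ?_⟩
  · rintro ⟨k, hk, hj⟩
    have hne : X k ≠ z := by rw [hk]; exact fun h => hzy (OnePoint.coe_injective h.symm)
    have hex : ∃ m, X m ≠ z := ⟨k, hne⟩
    have hle : Nat.find hex ≤ k := Nat.find_min' hex hne
    refine ⟨Nat.find hex, fun j h => not_not.1 (Nat.find_min hex h), Nat.find_spec hex,
      k - Nat.find hex, ?_, fun j h => hj _ (by omega)⟩
    simpa [shift, hle] using hk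
  · rintro ⟨m, hm, -, k, hk, hj⟩
    refine ⟨m + k, hk, fun j h a ha => ?_⟩
    by_cases hjm : j < m
    · rw [hm j hjm]
      exact fun h => hz (OnePoint.coe_injective h ▸ ha)
    · simpa [shift, show m + (j - m) = j by omega] using hj (j - m) (by omega) a ha

end IsGridChain

theorem exit_unique {X : ℕ → OnePoint S} {x : S} {m n : ℕ} (hm : ∀ j < m, X j = x)
    (hm' : X m ≠ x) (hn : ∀ j < n, X j = x) (hn' : X n ≠ x) : m = n := by
  rcases lt_trichotomy m n with h | h | h
  · exact absurd (hn m h) hm'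
  · exact h
  · exact absurd (hm n h) hn'

theorem mem_exitSet_avoidHit {X : ℕ → OnePoint S} {x y : S} {H : Set S} :
    X ∈ exitSet x (avoidHit H y) ↔ ∃ m k, m ≤ k ∧ (∀ j < m, X j = x) ∧ X m ≠ x ∧ X k = y ∧
      ∀ j, m ≤ j → j < k → ∀ h ∈ H, X j ≠ (h : OnePoint S) := by
  constructor
  · rintro ⟨m, h1, h2, k, hk, hj⟩
    refine ⟨m, m + k, by omega, h1, h2, hk, fun j h h' => ?_⟩
    simpa [shift, show m + (j - m) = j by omega] using hj (j - m) (by omega)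
  · rintro ⟨m, k, hmk, h1, h2, hk, hj⟩
    exact ⟨m, h1, h2, k - m, by simpa [shift, hmk] using hk,
      fun j h => hj _ (by omega) (by omega)⟩

/-- The index `k` lies between the exit from `x` and the first visit to `H`. -/
def beforeTaboo (x : S) (H : Set S) (k : ℕ) : Set (ℕ → OnePoint S) :=
  {X | ∃ m ≤ k, (∀ j < m, X j = x) ∧ X m ≠ x ∧
    ∀ j, m ≤ j → j < k → ∀ h ∈ H, X j ≠ (h : OnePoint S)}

/-- With `z` itself taboo, `k` is the first visit to `z` after the exit, hence unique. -/
theorem disjoint_beforeTaboo (x z : S) (H : Set S) :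
    Pairwise (Function.onFun Disjoint
      fun k => beforeTaboo x (insert z H) k ∩ {X | X k = z}) := by
  have key : ∀ k k' X, k < k' → X ∈ beforeTaboo x (insert z H) k ∩ {X | X k = z} →
      X ∉ beforeTaboo x (insert z H) k' ∩ {X | X k' = z} := by
    rintro k k' X hlt ⟨⟨m, hmk, h1, h2, h3⟩, hz⟩ ⟨⟨m', hmk', h1', h2', h3'⟩, hz'⟩
    obtain rfl := exit_unique h1 h2 h1' h2'
    exact h3' k hmk hlt z (mem_insert _ _) hz
  intro k k' hne
  rw [Function.onFun, Set.disjoint_left]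
  intro X h h'
  rcases lt_or_gt_of_ne hne with hlt | hlt
  · exact key _ _ X hlt h h'
  · exact key _ _ X hlt h' h

theorem exitSet_avoidHit_eq_iUnion (x y : S) (H : Set S) :
    exitSet x (avoidHit H y) = ⋃ k, (beforeTaboo x (insert y H) k ∩ {X | X k = y}) := by
  classical
  ext X
  simp only [mem_exitSet_avoidHit, mem_iUnion, beforeTaboo, mem_inter_iff, mem_ofPred_eq]
  constructor
  · rintro ⟨m, k, hmk, h1, h2, hk, hj⟩
    have hex : ∃ k, m ≤ k ∧ X k = y := ⟨k, hmk, hk⟩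
    obtain ⟨hm, hy⟩ := Nat.find_spec hex
    have hle : Nat.find hex ≤ k := Nat.find_min' hex ⟨hmk, hk⟩
    refine ⟨Nat.find hex, ⟨m, hm, h1, h2, fun j h h' => ?_⟩, hy⟩
    rintro a (rfl | ha)
    · exact fun e => Nat.find_min hex h' ⟨h, e⟩
    · exact hj j h (by omega) a ha
  · rintro ⟨k, ⟨m, hm, h1, h2, h3⟩, hk⟩
    exact ⟨m, k, hm, h1, h2, hk, fun j h h' a ha => h3 j h h' a (mem_insert_of_mem _ ha)⟩

/-- Either `y` is reached before `z`, or the path is cut at its first visit to `z`. Since `z ∉ H`,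
the two pieces can be glued again without violating the taboo. -/
theorem exitSet_avoidHit_split {x y z : S} {H : Set S} (hz : z ∉ H) :
    exitSet x (avoidHit H y) = exitSet x (avoidHit (insert z H) y) ∪
      ⋃ k, (beforeTaboo x (insert z (insert y H)) k ∩ {X | X k = z} ∩
        shift k ⁻¹' avoidHit H y) := by
  classical
  ext X
  constructor
  · intro hX
    rw [exitSet_avoidHit_eq_iUnion] at hX
    simp only [mem_iUnion, beforeTaboo, mem_inter_iff, mem_ofPred_eq] at hX
    obtain ⟨k, ⟨m, hm, h1, h2, h3⟩, hk⟩ := hX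
    by_cases hex : ∃ j, m ≤ j ∧ j < k ∧ X j = z
    · right
      obtain ⟨hj1, hj2, hj3⟩ := Nat.find_spec hex
      refine mem_iUnion.2 ⟨Nat.find hex, ⟨⟨m, hj1, h1, h2, fun j h h' => ?_⟩, hj3⟩,
        k - Nat.find hex, ?_, fun j h a ha => ?_⟩
      · rintro a (rfl | ha)
        · exact fun e => Nat.find_min hex h' ⟨h, by omega, e⟩
        · exact h3 j h (by omega) a ha
      · simpa [shift, hj2.le] using hk
      · exact h3 _ (by omega) (by omega) a (mem_insert_of_mem _ ha)
    · left
      push Not at hex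
      refine mem_exitSet_avoidHit.2 ⟨m, k, hm, h1, h2, hk, fun j h h' => ?_⟩
      rintro a (rfl | ha)
      · exact hex j h h'
      · exact h3 j h h' a (mem_insert_of_mem _ ha)
  · rintro (hX | hX)
    · rw [mem_exitSet_avoidHit] at hX ⊢
      obtain ⟨m, k, hmk, h1, h2, hk, hj⟩ := hX
      exact ⟨m, k, hmk, h1, h2, hk, fun j h h' a ha => hj j h h' a (mem_insert_of_mem _ ha)⟩
    · obtain ⟨k, ⟨⟨m, hm, h1, h2, h3⟩, hk⟩, i, hi, hj⟩ := mem_iUnion.1 hX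
      refine mem_exitSet_avoidHit.2 ⟨m, k + i, by omega, h1, h2, hi, fun j h h' a ha => ?_⟩
      rcases lt_trichotomy j k with hjk | rfl | hjk
      · exact h3 j h hjk a (mem_insert_of_mem _ (mem_insert_of_mem _ ha))
      · rw [show X j = z from hk]
        exact fun e => hz (OnePoint.coe_injective e ▸ ha)
      · simpa [shift, show k + (j - k) = j by omega] using hj (j - k) (by omega) a ha

theorem IsGridChain.measure_exitSet_avoidHit {μ : S → Measure (ℕ → OnePoint S)}
    (hμ : IsGridChain μ) {x y z : S} {H : Set S} (hzy : z ≠ y) (hz : z ∉ H) :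
    μ x (exitSet x (avoidHit H y)) = μ x (exitSet x (avoidHit (insert z H) y)) +
      μ x (exitSet x (avoidHit (insert y H) z)) * μ z (exitSet z (avoidHit H y)) := by
  have hdep : ∀ (k : ℕ) (X Y : ℕ → OnePoint S), (∀ j ≤ k, X j = Y j) →
      X ∈ beforeTaboo x (insert z (insert y H)) k →
      Y ∈ beforeTaboo x (insert z (insert y H)) k := by
    rintro k X Y h ⟨m, hm, h1, h2, h3⟩
    refine ⟨m, hm, fun j hj => ?_, ?_, fun j hj hj' => ?_⟩
    · rw [← h j (by omega)]; exact h1 j hj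
    · rwa [← h m hm]
    · rw [← h j hj'.le]; exact h3 j hj hj'
  have hBm : ∀ k, MeasurableSet (beforeTaboo x (insert z (insert y H)) k ∩ {X | X k = z}) := by
    intro k
    have : beforeTaboo x (insert z (insert y H)) k =
        ⋃ m, ⋃ _ : m ≤ k, ((⋂ j, ⋂ _ : j < m, {X | X j ∈ ({(x : OnePoint S)} : Set _)}) ∩
          ({X | X m ∈ ({(x : OnePoint S)} : Set _)ᶜ} ∩
          ⋂ j, ⋂ _ : m ≤ j, ⋂ _ : j < k, {X | X j ∈ {a : OnePoint S |
            ∀ h ∈ insert z (insert y H), a ≠ (h : OnePoint S)}})) := by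
      ext X
      simp only [beforeTaboo, mem_ofPred_eq, mem_iUnion, mem_inter_iff, mem_iInter,
        mem_singleton_iff, mem_compl_iff, exists_prop]
    rw [this]
    exact .inter (.iUnion fun m => .iUnion fun _ => .inter
      (.iInter fun j => .iInter fun _ => measurableSet_coord _ _)
      ((measurableSet_coord _ _).inter
        (.iInter fun j => .iInter fun _ => .iInter fun _ => measurableSet_coord _ _)))
      (measurableSet_coord k {(z : OnePoint S)})
  have hGm : ∀ k, MeasurableSet (beforeTaboo x (insert z (insert y H)) k ∩ {X | X k = z} ∩
      shift k ⁻¹' avoidHit H y) := fun k =>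
    (hBm k).inter (measurable_shift k (measurableSet_avoidHit H y))
  rw [exitSet_avoidHit_split hz, measure_union _ (.iUnion hGm), measure_iUnion _ hGm,
    exitSet_avoidHit_eq_iUnion x z, measure_iUnion (disjoint_beforeTaboo _ _ _) hBm,
    ← ENNReal.tsum_mul_right, ← hμ.measure_avoidHit hzy hz]
  · congr 2
    ext k
    exact hμ.markov x z k _ _ (hdep k) (measurableSet_avoidHit H y)
  · exact fun k k' hne => (disjoint_beforeTaboo x z (insert y H) hne).mono
      inter_subset_left inter_subset_left
  · rw [Set.disjoint_left]
    intro X hX hX'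
    obtain ⟨m, k, hmk, h1, h2, hk, hj⟩ := mem_exitSet_avoidHit.1 hX
    obtain ⟨i, ⟨⟨m', hm, h1', h2', h3⟩, hi⟩, -⟩ := mem_iUnion.1 hX'
    obtain rfl := exit_unique h1 h2 h1' h2'
    rcases lt_trichotomy i k with h | rfl | h
    · exact hj i hm h z (mem_insert _ _) hi
    · exact hzy (OnePoint.coe_injective ((show X i = z from hi).symm.trans hk))
    · exact h3 k hmk h y (by simp) hk

/-- A path at `y` at time `N` makes, right after its last visit to `x`, an excursion reaching `y`
before `x`. The bound sums over the `N` possible times of that visit. -/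
theorem IsGridChain.measure_visit_le {μ : S → Measure (ℕ → OnePoint S)}
    (hμ : IsGridChain μ) {x y : S} (hxy : x ≠ y) (N : ℕ) :
    μ x {X | X N = y} ≤ N * μ x {X | X 1 ≠ x ∧ shift 1 X ∈ avoidHit {x} y} := by
  classical
  have := hμ.prob x
  set D : Set (ℕ → OnePoint S) := {X | X 1 ≠ x ∧ shift 1 X ∈ avoidHit {x} y}
  have hD : MeasurableSet D := (measurableSet_coord 1 {(x : OnePoint S)}ᶜ).inter
    (measurable_shift 1 (measurableSet_avoidHit _ _))
  have hsub : ∀ᵐ X ∂(μ x), X ∈ {X : ℕ → OnePoint S | X N = y} →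
      X ∈ ⋃ k ∈ Finset.range N, (univ ∩ {X | X k = (x : OnePoint S)} ∩ shift k ⁻¹' D) := by
    filter_upwards [hμ.start x] with X hX hN
    have hNx : X N ≠ x := by
      rw [show X N = y from hN]; exact fun h => hxy (OnePoint.coe_injective h.symm)
    set k := Nat.findGreatest (fun k => X k = (x : OnePoint S)) N with hk
    have hkx : X k = x := Nat.findGreatest_spec (P := fun k => X k = (x : OnePoint S)) (Nat.zero_le N) hX
    have hkN : k ≤ N := Nat.findGreatest_le N
    have hlt : k < N := lt_of_le_of_ne hkN fun h => hNx (h ▸ hkx)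
    have hgr : ∀ j, k < j → j ≤ N → X j ≠ x := fun j h h' => Nat.findGreatest_is_greatest h h'
    simp only [mem_iUnion, Finset.mem_range]
    refine ⟨k, hlt, ⟨trivial, hkx⟩, hgr _ (by omega) (by omega), N - (k + 1), ?_, ?_⟩
    · simpa [shift, show k + (1 + (N - (k + 1))) = N by omega] using hN
    · rintro j hj a rfl
      exact hgr _ (by omega) (by omega)
  calc μ x {X | X N = y} ≤ μ x (⋃ k ∈ Finset.range N, (univ ∩ {X | X k = (x : OnePoint S)} ∩ shift k ⁻¹' D)) :=
        measure_mono_ae hsub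
    _ ≤ ∑ k ∈ Finset.range N, μ x (univ ∩ {X | X k = (x : OnePoint S)} ∩ shift k ⁻¹' D) :=
        measure_biUnion_finset_le _ _
    _ ≤ ∑ k ∈ Finset.range N, μ x D := by
        refine Finset.sum_le_sum fun k _ => ?_
        rw [hμ.markov x x k univ D (fun _ _ _ _ => trivial) hD]
        exact mul_le_of_le_one_left' prob_le_one
    _ = N * μ x D := by simp

end PathSpace

/-! ### The chain along a grid is a discrete-time Markov chain. -/

section Grid

attribute [local instance] discreteMeasurableSpace

variable {S Ω : Type*}

/-- The values of a path along the grid of mesh `h`. -/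
def grid (h : ℝ≥0) (f : ℝ≥0 → OnePoint S) : ℕ → OnePoint S := fun k => f (k * h)

/-- The law of the chain along the grid of mesh `h`. -/
noncomputable def gridLaw [MeasurableSpace Ω] (P : S → Measure Ω) (ξ : ℝ≥0 → Ω → OnePoint S)
    (h : ℝ≥0) (x : S) : Measure (ℕ → OnePoint S) :=
  (P x).map fun ω => grid h fun t => ξ t ω

/-- The coordinate events which determine the law of a chain on `S`. -/
def IsBasicEvent (A : Set (OnePoint S)) : Prop :=
  A = ∅ ∨ A = univ ∨ ∃ w : S, A = {(w : OnePoint S)}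

theorem IsBasicEvent.inter {A B : Set (OnePoint S)} (hA : IsBasicEvent A) (hB : IsBasicEvent B) :
    IsBasicEvent (A ∩ B) := by
  rcases hA with rfl | rfl | ⟨w, rfl⟩
  · exact .inl (empty_inter _)
  · rwa [univ_inter]
  · by_cases h : (w : OnePoint S) ∈ B
    · exact .inr (.inr ⟨w, inter_eq_left.2 (singleton_subset_iff.2 h)⟩)
    · exact .inl (singleton_inter_eq_empty.2 h)

/-- The cylinders over basic events. -/
def basicCylinders (S : Type*) : Set (Set (ℕ → OnePoint S)) :=
  {C | ∃ (m : ℕ) (s : ℕ → Set (OnePoint S)), (∀ i, IsBasicEvent (s i)) ∧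
    (∀ i, m ≤ i → s i = univ) ∧ C = {X | ∀ i, X i ∈ s i}}

theorem isPiSystem_basicCylinders : IsPiSystem (basicCylinders S) := by
  rintro _ ⟨m, s, hs, hs', rfl⟩ _ ⟨m', s', ht, ht', rfl⟩ -
  refine ⟨max m m', fun i => s i ∩ s' i, fun i => (hs i).inter (ht i), fun i hi => ?_, ?_⟩
  · simp [hs' i (le_trans (le_max_left _ _) hi), ht' i (le_trans (le_max_right _ _) hi)]
  · ext X; simp [forall_and]

/-- The Markov property is available only at points of `S`; the event of being at `∞` is recovered
as a complement of a countable union. -/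
theorem generateFrom_basicCylinders [Countable S] :
    (MeasurableSpace.pi : MeasurableSpace (ℕ → OnePoint S)) =
      MeasurableSpace.generateFrom (basicCylinders S) := by
  apply le_antisymm
  · refine iSup_le fun i => ?_
    rw [← measurable_iff_comap_le]
    have hpt : ∀ w : S, MeasurableSet[MeasurableSpace.generateFrom (basicCylinders S)]
        ((fun X : ℕ → OnePoint S => X i) ⁻¹' {(w : OnePoint S)}) := by
      classical
      intro w
      refine MeasurableSpace.measurableSet_generateFrom
        ⟨i + 1, fun j => if j = i then {(w : OnePoint S)} else univ, fun j => ?_, fun j hj => ?_, ?_⟩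
      · by_cases h : j = i
        · simpa [h] using .inr (.inr ⟨w, rfl⟩)
        · simpa [h] using .inr (.inl rfl)
      · simp [show j ≠ i by omega]
      · ext X
        simp only [mem_preimage, mem_singleton_iff, mem_ofPred_eq]
        constructor
        · intro h j
          by_cases hj : j = i
          · simp [hj, h]
          · simp [hj]
        · intro h; simpa using h i
    refine @measurable_to_countable' _ _ _ _ (_) _ fun a => ?_
    induction a using OnePoint.rec with
    | coe w => exact hpt w
    | infty =>
      have : ((fun X : ℕ → OnePoint S => X i) ⁻¹' {OnePoint.infty}) =
          (⋃ w : S, (fun X : ℕ → OnePoint S => X i) ⁻¹' {(w : OnePoint S)})ᶜ := by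
        ext X
        simp only [mem_preimage, mem_singleton_iff, mem_compl_iff, mem_iUnion, not_exists]
        rw [← not_iff_not, ← ne_eq, OnePoint.ne_infty_iff_exists]
        simp [eq_comm]
      rw [this]
      exact (MeasurableSet.iUnion hpt).compl
  · refine MeasurableSpace.generateFrom_le ?_
    rintro _ ⟨m, s, -, -, rfl⟩
    have : {X : ℕ → OnePoint S | ∀ i, X i ∈ s i} = ⋂ i, {X | X i ∈ s i} := by ext; simp
    rw [this]
    exact .iInter fun i => measurableSet_coord i _

variable {ξ : ℝ≥0 → Ω → OnePoint S}

theorem measurable_past {s t : ℝ≥0} (h : s ≤ t) : Measurable[past ξ t] (ξ s) :=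
  measurable_iff_comap_le.2
    (le_iSup (fun u : {u : ℝ≥0 // u ≤ t} => MeasurableSpace.comap (ξ u) ⊤) ⟨s, h⟩)

theorem past_mono {s t : ℝ≥0} (h : s ≤ t) : past ξ s ≤ past ξ t :=
  iSup_le fun u => measurable_iff_comap_le.1 (measurable_past (u.2.trans h))

variable [TopologicalSpace S] [MeasurableSpace Ω] {A : Matrix S S ℝ} {P : S → Measure Ω}

theorem IsMarkovChain.past_le (hξ : IsMarkovChain A P ξ) (s : ℝ≥0) :
    past ξ s ≤ ‹MeasurableSpace Ω› :=
  iSup_le fun u => measurable_iff_comap_le.1 (hξ.meas u)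

theorem IsMarkovChain.measurable_grid (hξ : IsMarkovChain A P ξ) (a h : ℝ≥0) :
    Measurable fun ω => grid h fun t => ξ (a + t) ω :=
  measurable_pi_lambda _ fun i => hξ.meas (a + i * h)

theorem IsMarkovChain.measurable_grid_zero (hξ : IsMarkovChain A P ξ) (h : ℝ≥0) :
    Measurable fun ω => grid h fun t => ξ t ω :=
  measurable_pi_lambda _ fun i => hξ.meas (i * h)

/-- The offset `j` counts grid steps since the last time at which a state was prescribed. An
unconstrained coordinate cannot be conditioned on, as the path may be at `∞`, so it only increases
`j`. -/
theorem IsMarkovChain.measure_cylinder (hξ : IsMarkovChain A P ξ) (h : ℝ≥0) (m : ℕ) :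
    ∀ (s : ℕ → Set (OnePoint S)), (∀ i, IsBasicEvent (s i)) → ∀ (j : ℕ) (a : ℝ≥0) (x z : S)
      (B : Set Ω), MeasurableSet[past ξ a] B →
    P x (B ∩ {ω | ξ a ω = z} ∩ {ω | ∀ i < m, ξ (a + (j + i : ℕ) * h) ω ∈ s i}) =
      P x (B ∩ {ω | ξ a ω = z}) * P z {ω | ∀ i < m, ξ ((j + i : ℕ) * h) ω ∈ s i} := by
  induction m with
  | zero =>
    intro s _ j a x z B _
    have := hξ.prob z
    simp
  | succ m ih =>
    intro s hs j a x z B hB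
    have e1 : ∀ b : ℝ≥0, {ω | ∀ i < m + 1, ξ (b + (j + i : ℕ) * h) ω ∈ s i} =
        {ω | ξ (b + j * h) ω ∈ s 0} ∩
          {ω | ∀ i < m, ξ (b + (j + 1 + i : ℕ) * h) ω ∈ s (i + 1)} := by
      intro b
      ext ω
      simp only [mem_ofPred_eq, mem_inter_iff, Nat.forall_lt_succ_left, add_zero]
      simp only [add_assoc, add_comm 1]
    have e2 := e1 0
    simp only [zero_add] at e2
    rw [e1, e2]
    rcases hs 0 with h0 | h0 | ⟨w, h0⟩
    · simp [h0]
    · simp only [h0, mem_univ, ofPred_true, univ_inter]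
      exact ih (fun i => s (i + 1)) (fun i => hs (i + 1)) (j + 1) a x z B hB
    · simp only [h0, mem_singleton_iff]
      have e3 : ∀ b : ℝ≥0, {ω | ∀ i < m, ξ (b + (j + 1 + i : ℕ) * h) ω ∈ s (i + 1)} =
          {ω | ∀ i < m, ξ ((b + j * h) + (1 + i : ℕ) * h) ω ∈ s (i + 1)} := by
        intro b
        ext ω
        simp only [mem_ofPred_eq]
        refine forall_congr' fun i => forall_congr' fun _ => ?_
        rw [show b + j * h + (1 + i : ℕ) * h = b + (j + 1 + i : ℕ) * h by push_cast; ring]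
      have e4 := e3 0
      simp only [zero_add] at e4
      -- A prescribed state `w` allows a restart: the constraint at time `a` joins the past, and the
      -- induction hypothesis is applied at `w` under both `P x` and `P z`.
      have hB' : MeasurableSet[past ξ (a + j * h)] (B ∩ {ω | ξ a ω = z}) :=
        .inter (past_mono (le_self_add) B hB)
          (measurable_past (le_self_add) (MeasurableSpace.measurableSet_top (s := {(z : OnePoint S)})))
      have i1 := ih (fun i => s (i + 1)) (fun i => hs (i + 1)) 1 (a + j * h) x w _ hB'
      have i2 := ih (fun i => s (i + 1)) (fun i => hs (i + 1)) 1 (j * h) z w univ .univ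
      rw [univ_inter] at i2
      rw [e3, e4, ← inter_assoc, i1, i2, hξ.markov x a (j * h) z w B hB, mul_assoc]

theorem IsMarkovChain.map_grid_restrict [Countable S] (hξ : IsMarkovChain A P ξ) (h a : ℝ≥0)
    (x z : S) {B : Set Ω} (hB : MeasurableSet[past ξ a] B) :
    ((P x).restrict (B ∩ {ω | ξ a ω = z})).map (fun ω => grid h fun t => ξ (a + t) ω) =
      P x (B ∩ {ω | ξ a ω = z}) • gridLaw P ξ h z := by
  have := hξ.prob x
  have := hξ.prob z
  have hD : MeasurableSet (B ∩ {ω | ξ a ω = z}) := (hξ.past_le a B hB).inter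
    (hξ.meas a (MeasurableSpace.measurableSet_top (s := {(z : OnePoint S)})))
  have hcyl : ∀ C ∈ basicCylinders S,
      ((P x).restrict (B ∩ {ω | ξ a ω = z})).map (fun ω => grid h fun t => ξ (a + t) ω) C =
        (P x (B ∩ {ω | ξ a ω = z}) • gridLaw P ξ h z) C := by
    intro C hC
    have hCm : MeasurableSet C := by
      rw [generateFrom_basicCylinders]
      exact MeasurableSpace.measurableSet_generateFrom hC
    obtain ⟨m, s, hs, hs', rfl⟩ := hC
    rw [Measure.map_apply (hξ.measurable_grid a h) hCm,
      Measure.restrict_apply (hξ.measurable_grid a h hCm), inter_comm, Measure.smul_apply, gridLaw,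
      Measure.map_apply (hξ.measurable_grid_zero h) hCm, smul_eq_mul]
    have key := hξ.measure_cylinder h m s hs 0 a x z B hB
    have e : ∀ f : ℕ → OnePoint S, (∀ i < m, f i ∈ s i) ↔ ∀ i, f i ∈ s i := fun f =>
      ⟨fun H i => (lt_or_ge i m).elim (H i) fun hi => by simp [hs' i hi], fun H i _ => H i⟩
    simp only [zero_add] at key
    convert key using 3
    · ext ω; exact (e fun i => ξ (a + i * h) ω).symm
    · ext ω; exact (e fun i => ξ (i * h) ω).symm
  refine ext_of_generate_finite _ generateFrom_basicCylinders isPiSystem_basicCylinders hcyl ?_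
  exact hcyl univ ⟨0, fun _ => univ, fun _ => .inr (.inl rfl), fun _ _ => rfl, by simp⟩

theorem IsMarkovChain.isGridChain [Countable S] (hξ : IsMarkovChain A P ξ) (h : ℝ≥0) :
    IsGridChain (gridLaw P ξ h) where
  prob x := by
    have := hξ.prob x
    exact Measure.isProbabilityMeasure_map (hξ.measurable_grid_zero h).aemeasurable
  start x := by
    refine (ae_map_iff (hξ.measurable_grid_zero h).aemeasurable
      (measurableSet_coord 0 {(x : OnePoint S)})).2 ?_
    filter_upwards [hξ.start x] with ω hω
    simpa [grid] using hω
  markov x z k B C hB hC := by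
    have hm := hξ.measurable_grid_zero h
    have hpast : MeasurableSet[past ξ (k * h)] ((fun ω => grid h fun t => ξ t ω) ⁻¹' B) := by
      -- `B` depends only on the first `k + 1` coordinates, which range over a countable discrete
      -- space; measurability is therefore automatic.
      let r : Ω → (Fin (k + 1) → OnePoint S) := fun ω i => ξ ((i : ℕ) * h) ω
      have hr : Measurable[past ξ (k * h)] r := by
        refine @measurable_pi_lambda _ _ _ (_) _ _ fun i => measurable_past ?_
        gcongr
        exact Nat.lt_succ_iff.1 i.2
      have : (fun ω => grid h fun t => ξ t ω) ⁻¹' B =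
          r ⁻¹' (r '' ((fun ω => grid h fun t => ξ t ω) ⁻¹' B)) := by
        refine (subset_preimage_image _ _).antisymm ?_
        rintro ω ⟨ω', hω', he⟩
        exact hB _ _ (fun j hj => congrFun he ⟨j, Nat.lt_succ_of_le hj⟩) hω'
      rw [this]
      exact hr (MeasurableSet.of_discrete)
    have hBm : ∀ D : Set (ℕ → OnePoint S), MeasurableSet D → gridLaw P ξ h x (B ∩ D) =
        P x (((fun ω => grid h fun t => ξ t ω) ⁻¹' B) ∩ ((fun ω => grid h fun t => ξ t ω) ⁻¹' D)) := by
      let r : (ℕ → OnePoint S) → (Fin (k + 1) → OnePoint S) := fun X i => X i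
      have hr : Measurable r := measurable_pi_lambda _ fun i => measurable_pi_apply (i : ℕ)
      have : B = r ⁻¹' (r '' B) := by
        refine (subset_preimage_image _ _).antisymm ?_
        rintro Y ⟨X, hX, he⟩
        exact hB X Y (fun j hj => congrFun he ⟨j, Nat.lt_succ_of_le hj⟩) hX
      have hBm : MeasurableSet B := by
        rw [this]
        exact hr (MeasurableSet.of_discrete)
      intro D hD
      rw [gridLaw, Measure.map_apply hm (hBm.inter hD), preimage_inter]
    have hz : MeasurableSet {X : ℕ → OnePoint S | X k = z} := measurableSet_coord k {(z : OnePoint S)}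
    rw [inter_assoc, hBm _ (hz.inter (measurable_shift k hC)), hBm _ hz]
    have key := congrArg (fun ν => ν C) (hξ.map_grid_restrict h (k * h) x z hpast)
    simp only [Measure.smul_apply, smul_eq_mul] at key
    rw [Measure.map_apply (hξ.measurable_grid _ h) hC,
      Measure.restrict_apply (hξ.measurable_grid _ h hC), inter_comm, inter_assoc] at key
    refine Eq.trans ?_ key
    have e : ∀ ω, shift k (grid h fun t => ξ t ω) = grid h fun t => ξ (k * h + t) ω := by
      intro ω
      ext i
      simp [shift, grid, add_mul]
    congr 2
    ext ω
    simp only [mem_preimage, mem_inter_iff, mem_ofPred_eq, e, grid]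

end Grid

/-! ### Right-continuous paths and their values on fine grids. -/

section Paths

variable {S : Type*}

/-- `τ` is the first time at which the path `f` is not in `x`. -/
def IsExit (f : ℝ≥0 → OnePoint S) (x : S) (τ : ℝ≥0) : Prop :=
  (∀ u < τ, f u = x) ∧ f τ ≠ x

/-- From time `τ` on, the path visits `y`, without a visit to `H` before. -/
def HitsFrom (f : ℝ≥0 → OnePoint S) (τ : ℝ≥0) (H : Set S) (y : S) : Prop :=
  ∃ t, τ ≤ t ∧ f t = y ∧ ∀ u, τ < u → u < t → ∀ h ∈ H, f u ≠ (h : OnePoint S)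

/-- Rounding up makes the grid times approach `t` from the right, the side on which paths are
continuous. -/
theorem tendsto_ceil_div_mul {δ : ℕ → ℝ≥0} (hδ : Tendsto δ atTop (𝓝 0)) (hpos : ∀ n, 0 < δ n)
    (t : ℝ≥0) : Tendsto (fun n => (⌈t / δ n⌉₊ : ℝ≥0) * δ n) atTop (𝓝[≥] t) := by
  have hle : ∀ n, t ≤ (⌈t / δ n⌉₊ : ℝ≥0) * δ n := fun n => by
    have := Nat.le_ceil (t / δ n)
    rwa [div_le_iff₀ (hpos n)] at this
  have hle' : ∀ n, (⌈t / δ n⌉₊ : ℝ≥0) * δ n ≤ t + δ n := fun n => by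
    have := (Nat.ceil_lt_add_one (zero_le (a := t / δ n))).le
    calc (⌈t / δ n⌉₊ : ℝ≥0) * δ n ≤ (t / δ n + 1) * δ n := by gcongr
      _ = t + δ n := by rw [add_mul, one_mul, div_mul_cancel₀ _ (hpos n).ne']
  refine tendsto_nhdsWithin_iff.2 ⟨?_, Eventually.of_forall hle⟩
  refine tendsto_of_tendsto_of_tendsto_of_le_of_le tendsto_const_nhds ?_ hle hle'
  simpa using tendsto_const_nhds.add hδ

theorem lt_ceil_div_iff {δ t : ℝ≥0} (hδ : 0 < δ) (k : ℕ) : k < ⌈t / δ⌉₊ ↔ k * δ < t := by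
  rw [Nat.lt_ceil, lt_div_iff₀ hδ]

theorem ceil_div_le_iff {δ t : ℝ≥0} (hδ : 0 < δ) (k : ℕ) : ⌈t / δ⌉₊ ≤ k ↔ t ≤ k * δ := by
  rw [Nat.ceil_le, div_le_iff₀ hδ]

variable [TopologicalSpace S] [DiscreteTopology S] {f : ℝ≥0 → OnePoint S}

theorem eventually_eq_of_rightCont (hf : ∀ t, ContinuousWithinAt f (Ici t) t) {t : ℝ≥0} {y : S}
    (h : f t = y) : ∀ᶠ u in 𝓝[≥] t, f u = y := by
  have ho : IsOpen {(y : OnePoint S)} := by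
    simpa using OnePoint.isOpenEmbedding_coe.isOpenMap {y} (isOpen_discrete _)
  exact (hf t).eventually (p := fun a => a = (y : OnePoint S)) (ho.mem_nhds h)

theorem eventually_ne_of_rightCont (hf : ∀ t, ContinuousWithinAt f (Ici t) t) {t : ℝ≥0} {y : S}
    (h : f t ≠ y) : ∀ᶠ u in 𝓝[≥] t, f u ≠ y :=
  (hf t).eventually (p := fun a => a ≠ (y : OnePoint S)) (isOpen_ne.mem_nhds h)

theorem exists_gt_of_eventually {t : ℝ≥0} {p : ℝ≥0 → Prop} (h : ∀ᶠ u in 𝓝[≥] t, p u) :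
    ∃ v > t, ∀ u, t ≤ u → u < v → p u := by
  obtain ⟨v, hv, hs⟩ := (mem_nhdsGE_iff_exists_Ico_subset (a := t)).1 h
  exact ⟨v, hv, fun u h1 h2 => hs ⟨h1, h2⟩⟩

/-- The infimum is attained: a path away from `y` at that time would stay away for a while. -/
theorem exists_first_visit (hf : ∀ t, ContinuousWithinAt f (Ici t) t) {τ : ℝ≥0} {y : S}
    (h : ∃ t, τ ≤ t ∧ f t = y) :
    ∃ T, τ ≤ T ∧ f T = y ∧ ∀ u, τ ≤ u → u < T → f u ≠ y := by
  set V := {t | τ ≤ t ∧ f t = y}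
  have hne : V.Nonempty := h
  have hlow : ∀ u, τ ≤ u → u < sInf V → f u ≠ y := fun u h1 h2 e =>
    notMem_of_lt_csInf' h2 ⟨h1, e⟩
  refine ⟨sInf V, le_csInf hne fun t ht => ht.1, ?_, hlow⟩
  by_contra hT
  obtain ⟨v, hv, hs⟩ := exists_gt_of_eventually (eventually_ne_of_rightCont hf hT)
  obtain ⟨t, ht, htv⟩ := (csInf_lt_iff (OrderBot.bddBelow V) hne).1 hv
  exact hs t (csInf_le' ht) htv ht.2

theorem exists_isExit (hf : ∀ t, ContinuousWithinAt f (Ici t) t) {x : S} (h : ∃ t, f t ≠ x) :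
    ∃ τ, IsExit f x τ := by
  set V := {t | f t ≠ x}
  have hne : V.Nonempty := h
  refine ⟨sInf V, fun u hu => not_not.1 (notMem_of_lt_csInf' hu), fun hT => ?_⟩
  obtain ⟨v, hv, hs⟩ := exists_gt_of_eventually (eventually_eq_of_rightCont hf hT)
  obtain ⟨t, ht, htv⟩ := (csInf_lt_iff (OrderBot.bddBelow V) hne).1 hv
  exact ht (hs t (csInf_le' ht) htv)

omit [TopologicalSpace S] [DiscreteTopology S] in
theorem IsExit.unique {x : S} {τ σ : ℝ≥0} (h : IsExit f x τ) (h' : IsExit f x σ) : τ = σ := by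
  rcases lt_trichotomy τ σ with hl | hl | hl
  · exact absurd (h'.1 τ hl) h.2
  · exact hl
  · exact absurd (h.1 σ hl) h'.2

variable {δ : ℕ → ℝ≥0} (hδ : Tendsto δ atTop (𝓝 0)) (hpos : ∀ n, 0 < δ n)
include hδ hpos

theorem IsExit.eventually_exitSet (hf : ∀ t, ContinuousWithinAt f (Ici t) t) {x : S} {τ : ℝ≥0}
    (h : IsExit f x τ) : ∀ᶠ n in atTop, ∀ C : Set (ℕ → OnePoint S),
      grid (δ n) f ∈ exitSet x C ↔ shift ⌈τ / δ n⌉₊ (grid (δ n) f) ∈ C := by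
  filter_upwards [(tendsto_ceil_div_mul hδ hpos τ).eventually
    (eventually_ne_of_rightCont hf h.2)] with n hn C
  have hb : ∀ j < ⌈τ / δ n⌉₊, grid (δ n) f j = x := fun j hj =>
    h.1 _ ((lt_ceil_div_iff (hpos n) j).1 hj)
  constructor
  · rintro ⟨m, h1, h2, h3⟩
    rwa [exit_unique h1 h2 hb hn] at h3
  · exact fun hC => ⟨_, hb, hn, hC⟩

theorem eventually_shift_grid_zero (hf : ∀ t, ContinuousWithinAt f (Ici t) t) (τ : ℝ≥0) (w : S) :
    ∀ᶠ n in atTop, shift ⌈τ / δ n⌉₊ (grid (δ n) f) 0 = w ↔ f τ = w := by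
  by_cases h : f τ = w
  · filter_upwards [(tendsto_ceil_div_mul hδ hpos τ).eventually
      (eventually_eq_of_rightCont hf h)] with n hn
    exact iff_of_true hn h
  · filter_upwards [(tendsto_ceil_div_mul hδ hpos τ).eventually
      (eventually_ne_of_rightCont hf h)] with n hn
    exact iff_of_false hn h

theorem eventually_shift_grid_avoidHit (hf : ∀ t, ContinuousWithinAt f (Ici t) t) (τ : ℝ≥0)
    (H : Set S) (y : S) : ∀ᶠ n in atTop,
      shift ⌈τ / δ n⌉₊ (grid (δ n) f) ∈ avoidHit H y ↔ HitsFrom f τ H y := by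
  by_cases h : HitsFrom f τ H y
  · obtain ⟨t, hτt, hy, hH⟩ := h
    filter_upwards [(tendsto_ceil_div_mul hδ hpos t).eventually
      (eventually_eq_of_rightCont hf hy)] with n hn
    refine iff_of_true ?_ ⟨t, hτt, hy, hH⟩
    have hle : ⌈τ / δ n⌉₊ ≤ ⌈t / δ n⌉₊ := by gcongr
    refine ⟨⌈t / δ n⌉₊ - ⌈τ / δ n⌉₊, by simpa [shift, grid, hle] using hn, fun j hj a ha => ?_⟩
    have h1 : ((⌈τ / δ n⌉₊ + j : ℕ) : ℝ≥0) * δ n < t := (lt_ceil_div_iff (hpos n) _).1 (by omega)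
    have h2 : τ ≤ ((⌈τ / δ n⌉₊ + j : ℕ) : ℝ≥0) * δ n := (ceil_div_le_iff (hpos n) _).1 (by omega)
    intro e
    obtain ⟨v, hv, hs⟩ := exists_gt_of_eventually (eventually_eq_of_rightCont hf e)
    -- The taboo interval is open at `τ`, while the grid point may equal `τ`; right-continuity moves
    -- the forbidden visit strictly inside.
    obtain ⟨u, hu1, hu2⟩ := exists_between (lt_min h1 hv)
    exact hH u (h2.trans_lt hu1) (hu2.trans_le (min_le_left _ _)) a ha
      (hs u hu1.le (hu2.trans_le (min_le_right _ _)))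
  by_cases hvis : ∃ t, τ ≤ t ∧ f t = y
  · obtain ⟨T, hτT, hy, hT⟩ := exists_first_visit hf hvis
    -- A taboo visit before the first visit `T` to `y` persists to a nearby grid point, still before
    -- `T`, and so spoils every later grid visit to `y`.
    have hex : ∃ u, τ < u ∧ u < T ∧ ∃ a ∈ H, f u = (a : OnePoint S) := by
      by_contra hno
      push Not at hno
      exact h ⟨T, hτT, hy, hno⟩
    obtain ⟨u, hτu, huT, a, ha, hu⟩ := hex
    have htend := tendsto_ceil_div_mul hδ hpos u
    filter_upwards [htend.eventually (eventually_eq_of_rightCont hf hu),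
      (tendsto_nhds_of_tendsto_nhdsWithin htend).eventually (gt_mem_nhds huT)] with n hn hn'
    refine iff_of_false ?_ h
    rintro ⟨k, hk, hj⟩
    have hle : ⌈τ / δ n⌉₊ ≤ ⌈u / δ n⌉₊ := by gcongr
    have hk' : T ≤ ((⌈τ / δ n⌉₊ + k : ℕ) : ℝ≥0) * δ n := by
      by_contra hlt
      exact hT _ ((ceil_div_le_iff (hpos n) _).1 (Nat.le_add_right _ _)) (not_le.1 hlt) hk
    have hlt : ⌈u / δ n⌉₊ < ⌈τ / δ n⌉₊ + k := by
      have := lt_of_mul_lt_mul_right (hn'.trans_le hk') (zero_le (a := δ n))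
      exact_mod_cast this
    exact hj (⌈u / δ n⌉₊ - ⌈τ / δ n⌉₊) (by omega) a ha (by simpa [shift, grid, hle] using hn)
  · refine Eventually.of_forall fun n => iff_of_false ?_ h
    rintro ⟨k, hk, -⟩
    exact hvis ⟨_, (ceil_div_le_iff (hpos n) _).1 (Nat.le_add_right _ k), hk⟩

/-- If along fine grids, after the grid time following `τ`, membership in `C` expresses the
property `Q τ` of the path, then membership in `exitSet x C` expresses `Q` at the exit time. -/
theorem eventually_exitSet_iff (hf : ∀ t, ContinuousWithinAt f (Ici t) t) (x : S)
    {C : Set (ℕ → OnePoint S)} {Q : ℝ≥0 → Prop}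
    (hC : ∀ τ, ∀ᶠ n in atTop, shift ⌈τ / δ n⌉₊ (grid (δ n) f) ∈ C ↔ Q τ) :
    ∀ᶠ n in atTop, grid (δ n) f ∈ exitSet x C ↔ ∃ τ, IsExit f x τ ∧ Q τ := by
  by_cases h : ∃ t, f t ≠ x
  · obtain ⟨τ, hτ⟩ := exists_isExit hf h
    filter_upwards [hτ.eventually_exitSet hδ hpos hf, hC τ] with n h1 h2
    rw [h1, h2]
    exact ⟨fun hQ => ⟨τ, hτ, hQ⟩, fun ⟨σ, hσ, hQ⟩ => hτ.unique hσ ▸ hQ⟩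
  · refine Eventually.of_forall fun n => iff_of_false ?_ ?_
    · rintro ⟨m, -, h2, -⟩
      exact h ⟨_, h2⟩
    · rintro ⟨τ, hτ, -⟩
      exact h ⟨τ, hτ.2⟩

end Paths

/-! ### Convergence of grid probabilities to hitting probabilities. -/

section Limit

attribute [local instance] discreteMeasurableSpace

variable {S Ω : Type*} [TopologicalSpace S] [DiscreteTopology S] [MeasurableSpace Ω]
  {A : Matrix S S ℝ} {P : S → Measure Ω} {ξ : ℝ≥0 → Ω → OnePoint S}

omit [MeasurableSpace Ω] in
theorem hitTime_lt_top_iff (hf : ∀ ω t, ContinuousWithinAt (fun u => ξ u ω) (Ici t) t)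
    {ω : Ω} {x : S} (h0 : ξ 0 ω = x) (H : Set S) (y : S) :
    hitTime ξ H x y ω < ⊤ ↔
      ∃ τ, IsExit (fun t => ξ t ω) x τ ∧ HitsFrom (fun t => ξ t ω) τ H y := by
  have hmem : ω ∈ {ω | ξ 0 ω = (x : OnePoint S)} := h0
  have hexit : ∀ τ, IsExit (fun t => ξ t ω) x τ → exitTime ξ x ω = τ := by
    intro τ hτ
    rw [exitTime, indicator_of_mem hmem]
    refine le_antisymm (sInf_le ⟨τ, rfl, hτ.2⟩) (le_sInf ?_)
    rintro _ ⟨t, rfl, ht⟩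
    exact ENNReal.coe_le_coe.2 (not_lt.1 fun hlt => ht (hτ.1 t hlt))
  rw [hitTime, indicator_of_mem hmem, sInf_lt_iff]
  constructor
  · rintro ⟨_, ⟨t, rfl, h1, h2, h3⟩, -⟩
    have hex : ∃ t, ξ t ω ≠ x := by
      by_contra hno
      rw [exitTime, indicator_of_mem hmem, sInf_eq_top.2] at h1
      · exact absurd h1 (by simp)
      · rintro _ ⟨t, rfl, ht⟩
        exact absurd ⟨t, ht⟩ hno
    obtain ⟨τ, hτ⟩ := exists_isExit (hf ω) hex
    rw [hexit τ hτ] at h1 h3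
    exact ⟨τ, hτ, t, by exact_mod_cast h1, h2,
      fun u hu => h3 u (by exact_mod_cast hu)⟩
  · rintro ⟨τ, hτ, t, h1, h2, h3⟩
    refine ⟨t, ⟨t, rfl, ?_, h2, ?_⟩, ENNReal.coe_lt_top⟩
    · rw [hexit τ hτ]; exact_mod_cast h1
    · intro u hu
      rw [hexit τ hτ] at hu
      exact h3 u (by exact_mod_cast hu)

variable (hξ : IsMarkovChain A P ξ) {δ : ℕ → ℝ≥0} (hδ : Tendsto δ atTop (𝓝 0))
  (hpos : ∀ n, 0 < δ n)
include hξ hδ hpos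

/-- Indicators converge pointwise, so the limit event inherits measurability and dominated
convergence applies. -/
theorem IsMarkovChain.tendsto_gridLaw (x : S) {C : Set (ℕ → OnePoint S)} (hC : MeasurableSet C)
    {Q : Ω → ℝ≥0 → Prop}
    (hQ : ∀ ω τ, ∀ᶠ n in atTop, shift ⌈τ / δ n⌉₊ (grid (δ n) fun t => ξ t ω) ∈ C ↔ Q ω τ) :
    MeasurableSet {ω | ∃ τ, IsExit (fun t => ξ t ω) x τ ∧ Q ω τ} ∧
    Tendsto (fun n => gridLaw P ξ (δ n) x (exitSet x C)) atTop
      (𝓝 (P x {ω | ∃ τ, IsExit (fun t => ξ t ω) x τ ∧ Q ω τ})) := by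
  have := hξ.prob x
  have hlim : ∀ ω, ∀ᶠ n in atTop, ω ∈ (fun ω => grid (δ n) fun t => ξ t ω) ⁻¹' exitSet x C ↔
      ω ∈ {ω | ∃ τ, IsExit (fun t => ξ t ω) x τ ∧ Q ω τ} := fun ω =>
    eventually_exitSet_iff hδ hpos (hξ.right_cont ω) x (hQ ω)
  have hm : ∀ n, MeasurableSet ((fun ω => grid (δ n) fun t => ξ t ω) ⁻¹' exitSet x C) := fun n =>
    hξ.measurable_grid_zero (δ n) (measurableSet_exitSet x hC)
  refine ⟨measurableSet_of_tendsto_indicator atTop hm hlim, ?_⟩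
  simp_rw [gridLaw, Measure.map_apply (hξ.measurable_grid_zero _) (measurableSet_exitSet x hC)]
  exact tendsto_measure_of_tendsto_indicator_of_isFiniteMeasure atTop _ hm hlim

theorem IsMarkovChain.tendsto_avoidHit (x y : S) (H : Set S) :
    Tendsto (fun n => gridLaw P ξ (δ n) x (exitSet x (avoidHit H y))) atTop
      (𝓝 (P x {ω | hitTime ξ H x y ω < ⊤})) := by
  have h : P x {ω | hitTime ξ H x y ω < ⊤} = P x {ω | ∃ τ, IsExit (fun t => ξ t ω) x τ ∧
      HitsFrom (fun t => ξ t ω) τ H y} := measure_congr <| by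
    filter_upwards [hξ.start x] with ω hω
    exact propext (hitTime_lt_top_iff hξ.right_cont hω H y)
  rw [h]
  exact (hξ.tendsto_gridLaw hδ hpos x (measurableSet_avoidHit H y) fun ω τ =>
    eventually_shift_grid_avoidHit hδ hpos (hξ.right_cont ω) τ H y).2

end Limit

/-! ### Jump rates and the law at the exit time. -/

section Identities

attribute [local instance] discreteMeasurableSpace

variable {S Ω : Type*} [TopologicalSpace S] [MeasurableSpace Ω]
  {A : Matrix S S ℝ} {P : S → Measure Ω} {ξ : ℝ≥0 → Ω → OnePoint S}

theorem IsMarkovChain.gridLaw_coord (hξ : IsMarkovChain A P ξ) (h : ℝ≥0) (x w : S) (k : ℕ) :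
    (gridLaw P ξ h x).real {X | X k = w} = transProb P ξ (k * h) x w := by
  have hm : MeasurableSet {X : ℕ → OnePoint S | X k = w} := measurableSet_coord k {(w : OnePoint S)}
  rw [gridLaw, map_measureReal_apply (hξ.measurable_grid_zero h) hm]
  rfl

theorem IsMarkovChain.transProb_zero_self (hξ : IsMarkovChain A P ξ) (x : S) :
    transProb P ξ 0 x x = 1 := by
  have := hξ.prob x
  rw [transProb, measureReal_def, (prob_compl_eq_zero_iff _).1 (hξ.start x), ENNReal.toReal_one]
  exact hξ.meas 0 (MeasurableSpace.measurableSet_top (s := {(x : OnePoint S)}))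

theorem IsMarkovChain.transProb_zero_of_ne (hξ : IsMarkovChain A P ξ) {x w : S} (hw : w ≠ x) :
    transProb P ξ 0 x w = 0 := by
  rw [transProb, measureReal_def, measure_eq_zero_iff_ae_notMem.2, ENNReal.toReal_zero]
  filter_upwards [hξ.start x] with ω hω h
  exact hw (OnePoint.coe_injective ((show ξ 0 ω = w from h).symm.trans hω))

variable {δ : ℕ → ℝ≥0} (hδ : Tendsto δ atTop (𝓝 0)) (hpos : ∀ n, 0 < δ n)
include hδ hpos

theorem IsMarkovChain.tendsto_generator (hξ : IsMarkovChain A P ξ) (x w : S) :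
    Tendsto (fun n => (transProb P ξ (δ n) x w - transProb P ξ 0 x w) / (δ n : ℝ)) atTop
      (𝓝 (A x w)) :=
  (hξ.generator x w).comp
    (tendsto_nhdsWithin_iff.2 ⟨hδ, Eventually.of_forall hpos⟩)

theorem IsMarkovChain.tendsto_exit_rate (hξ : IsMarkovChain A P ξ) (x : S) :
    Tendsto (fun n => (1 - transProb P ξ (δ n) x x) / (δ n : ℝ)) atTop (𝓝 (-A x x)) := by
  refine (hξ.tendsto_generator hδ hpos x x).neg.congr fun n => ?_
  rw [hξ.transProb_zero_self, ← neg_div, neg_sub]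

theorem IsMarkovChain.eventually_exit_pos (hA : IsConservativeQMatrix A)
    (hξ : IsMarkovChain A P ξ) (x : S) :
    ∀ᶠ n in atTop, 0 < 1 - transProb P ξ (δ n) x x := by
  filter_upwards [(hξ.tendsto_exit_rate hδ hpos x).eventually
    (lt_mem_nhds (neg_pos.2 (hA.diag_neg x)))] with n hn
  exact (div_pos_iff_of_pos_right (by exact_mod_cast hpos n)).1 hn

theorem IsMarkovChain.tendsto_jump (hA : IsConservativeQMatrix A) (hξ : IsMarkovChain A P ξ)
    {x w : S} (hw : w ≠ x) :
    Tendsto (fun n => (1 - transProb P ξ (δ n) x x)⁻¹ * transProb P ξ (δ n) x w) atTop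
      (𝓝 (A x w / -A x x)) := by
  have h := (hξ.tendsto_generator hδ hpos x w).div (hξ.tendsto_exit_rate hδ hpos x)
    (neg_pos.2 (hA.diag_neg x)).ne'
  refine h.congr fun n => ?_
  have : (δ n : ℝ) ≠ 0 := by exact_mod_cast (hpos n).ne'
  simp only [Pi.div_apply]
  rw [hξ.transProb_zero_of_ne hw, sub_zero, div_div_div_cancel_right₀ this, div_eq_inv_mul]

omit hδ hpos in
theorem IsMarkovChain.toReal_one_sub [Countable S] (hξ : IsMarkovChain A P ξ) (h : ℝ≥0) (x : S) :
    (1 - gridLaw P ξ h x {X | X 1 = x}).toReal = 1 - transProb P ξ h x x := by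
  have := (hξ.isGridChain h).prob x
  rw [ENNReal.toReal_sub_of_le prob_le_one ENNReal.one_ne_top, ENNReal.toReal_one,
    ← measureReal_def, hξ.gridLaw_coord, Nat.cast_one, one_mul]

variable [DiscreteTopology S] [Countable S]

/-- The joint law of the exit state and the evolution after the exit. -/
theorem IsMarkovChain.measure_exit_state (hA : IsConservativeQMatrix A)
    (hξ : IsMarkovChain A P ξ) {x w : S} (hw : w ≠ x) {C : Set (ℕ → OnePoint S)}
    (hC : MeasurableSet C) {Q : Ω → ℝ≥0 → Prop} {c : ℝ}
    (hQ : ∀ ω τ, ∀ᶠ n in atTop, shift ⌈τ / δ n⌉₊ (grid (δ n) fun t => ξ t ω) ∈ C ↔ Q ω τ)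
    (hc : Tendsto (fun n => (gridLaw P ξ (δ n) w).real C) atTop (𝓝 c)) :
    MeasurableSet {ω | ∃ τ, IsExit (fun t => ξ t ω) x τ ∧ ξ τ ω = w ∧ Q ω τ} ∧
    (P x).real {ω | ∃ τ, IsExit (fun t => ξ t ω) x τ ∧ ξ τ ω = w ∧ Q ω τ} =
      A x w / -A x x * c := by
  have := hξ.prob x
  have hCm : MeasurableSet ({X : ℕ → OnePoint S | X 0 = w} ∩ C) :=
    .inter (measurableSet_coord 0 {(w : OnePoint S)}) hC
  obtain ⟨hm, hlim⟩ := hξ.tendsto_gridLaw hδ hpos x hCm (Q := fun ω τ => ξ τ ω = w ∧ Q ω τ)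
    fun ω τ => by
      filter_upwards [hQ ω τ, eventually_shift_grid_zero hδ hpos (hξ.right_cont ω) τ w] with n h1 h2
      exact and_congr h2 h1
  refine ⟨hm, tendsto_nhds_unique ((ENNReal.tendsto_toReal (measure_ne_top _ _)).comp hlim) ?_⟩
  refine ((hξ.tendsto_jump hδ hpos hA hw).mul hc).congr fun n => ?_
  simp only [Function.comp_apply]
  rw [(hξ.isGridChain (δ n)).measure_exitSet_state hw hC, ENNReal.toReal_mul, ENNReal.toReal_mul,
    ENNReal.toReal_inv, hξ.toReal_one_sub, ← measureReal_def, hξ.gridLaw_coord, Nat.cast_one,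
    one_mul, mul_assoc]
  rfl

theorem IsMarkovChain.tendsto_hitProb (hξ : IsMarkovChain A P ξ) (H : Set S) (x y : S) :
    Tendsto (fun n => (gridLaw P ξ (δ n) x).real (exitSet x (avoidHit H y))) atTop
      (𝓝 (hitProb P ξ H x y)) := by
  have := hξ.prob x
  exact (ENNReal.tendsto_toReal (measure_ne_top _ _)).comp (hξ.tendsto_avoidHit hδ hpos x y H)

-- Here time 0 counts: a start at `y` is already a hit, and any other start in `H` already violates
-- the taboo.
open Classical in
theorem IsMarkovChain.tendsto_avoidHit_start (hξ : IsMarkovChain A P ξ) (H : Set S) (w y : S) :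
    Tendsto (fun n => (gridLaw P ξ (δ n) w).real (avoidHit H y)) atTop
      (𝓝 (if w = y then 1 else if w ∈ H then 0 else hitProb P ξ H w y)) := by
  split_ifs with hy hH
  · subst hy
    refine tendsto_const_nhds.congr fun n => ?_
    have := (hξ.isGridChain (δ n)).prob w
    rw [measureReal_def, (hξ.isGridChain (δ n)).measure_congr_start w (D := univ) fun X hX =>
      iff_of_true (show X ∈ avoidHit H w from ⟨0, hX, by simp⟩) trivial, measure_univ, ENNReal.toReal_one]
  · refine tendsto_const_nhds.congr fun n => ?_
    rw [measureReal_def, (hξ.isGridChain (δ n)).measure_congr_start w (D := ∅) fun X hX =>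
      iff_of_false ?_ (notMem_empty _), measure_empty, ENNReal.toReal_zero]
    rintro ⟨k, hk, hj⟩
    rcases Nat.eq_zero_or_pos k with rfl | hk0
    · exact hy (OnePoint.coe_injective (hX.symm.trans hk))
    · exact hj 0 hk0 w hH hX
  · refine (hξ.tendsto_hitProb hδ hpos H w y).congr fun n => ?_
    rw [measureReal_def, measureReal_def, (hξ.isGridChain (δ n)).measure_avoidHit hy hH]

/-! ### Decompositions and strict inequalities for hitting probabilities. -/

omit hδ hpos

theorem exists_mesh (t : ℝ≥0) (ht : 0 < t) : Tendsto (fun n : ℕ => t / (n + 1 : ℕ)) atTop (𝓝 0) ∧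
    ∀ n : ℕ, 0 < t / (n + 1 : ℕ) :=
  ⟨(tendsto_const_div_atTop_nhds_zero_nat t).comp (tendsto_add_atTop_nat 1),
    fun n => by positivity⟩

/-- Decomposition at the first visit to `z`. -/
theorem IsMarkovChain.hitProb_decomp (hξ : IsMarkovChain A P ξ) {H : Set S} {x y z : S}
    (hzy : z ≠ y) (hz : z ∉ H) :
    hitProb P ξ H x y = hitProb P ξ (insert z H) x y +
      hitProb P ξ (insert y H) x z * hitProb P ξ H z y := by
  obtain ⟨hδ, hpos⟩ := exists_mesh 1 one_pos
  refine tendsto_nhds_unique (hξ.tendsto_hitProb hδ hpos H x y)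
    (((hξ.tendsto_hitProb hδ hpos _ x y).add ((hξ.tendsto_hitProb hδ hpos _ x z).mul
      (hξ.tendsto_hitProb hδ hpos H z y))).congr fun n => ?_)
  have hg := hξ.isGridChain ((1 : ℝ≥0) / (n + 1 : ℕ))
  have := hg.prob x
  have := hg.prob z
  simp only [measureReal_def]
  rw [hg.measure_exitSet_avoidHit hzy hz (x := x), ENNReal.toReal_add (measure_ne_top _ _)
    (ENNReal.mul_ne_top (measure_ne_top _ _) (measure_ne_top _ _)), ENNReal.toReal_mul]

/-- The mesh `t / (n + 1)` puts `t` on the grid. The `n + 1` possible last visits to `x` each cost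
the one-step exit probability, and their total tends to `t * -A x x`. -/
theorem IsMarkovChain.transProb_le (hA : IsConservativeQMatrix A) (hξ : IsMarkovChain A P ξ)
    {x y : S} (hxy : x ≠ y) {t : ℝ≥0} (ht : 0 < t) :
    transProb P ξ t x y ≤ t * -A x x * hitProb P ξ {x} x y := by
  obtain ⟨hδ, hpos⟩ := exists_mesh t ht
  refine ge_of_tendsto ((tendsto_const_nhds.mul (hξ.tendsto_exit_rate hδ hpos x)).mul
    (hξ.tendsto_hitProb hδ hpos {x} x y)) ?_
  filter_upwards [hξ.eventually_exit_pos hδ hpos hA x] with n hn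
  set h := t / (n + 1 : ℕ) with hh
  have hg := hξ.isGridChain h
  have := hg.prob x
  have hth : ((n + 1 : ℕ) : ℝ≥0) * h = t := by rw [hh]; field_simp
  have h1 := ENNReal.toReal_mono (ENNReal.mul_ne_top (by simp) (measure_ne_top _ _))
    (hg.measure_visit_le hxy (n + 1))
  rw [← measureReal_def, hξ.gridLaw_coord, hth, ENNReal.toReal_mul] at h1
  have h2 := congrArg ENNReal.toReal (hg.measure_exitSet x (measurableSet_avoidHit {x} y))
  rw [ENNReal.toReal_mul, ENNReal.toReal_inv, hξ.toReal_one_sub, eq_inv_mul_iff_mul_eq₀ hn.ne'] at h2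
  rw [← h2] at h1
  refine h1.trans (le_of_eq ?_)
  have ht' : (t : ℝ) = (n + 1 : ℕ) * (h : ℝ) := by rw [← hth]; push_cast; ring
  have hh0 : (h : ℝ) ≠ 0 := by exact_mod_cast (hpos n).ne'
  rw [ht', ENNReal.toReal_natCast, measureReal_def]
  field_simp

theorem IsMarkovChain.hitProb_pos (hA : IsConservativeQMatrix A) (hξ : IsMarkovChain A P ξ)
    (hirr : IsIrreducible P ξ) {x y : S} (hxy : x ≠ y) : 0 < hitProb P ξ {x} x y := by
  obtain ⟨t, ht, hp⟩ := hirr x y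
  have h := hp.trans_le (hξ.transProb_le hA hxy ht)
  exact pos_of_mul_pos_right h
    (mul_nonneg t.2 (neg_pos.2 (hA.diag_neg x)).le)

omit [DiscreteTopology S] [Countable S] in
theorem IsMarkovChain.hitProb_le_one (hξ : IsMarkovChain A P ξ) (H : Set S) (x y : S) :
    hitProb P ξ H x y ≤ 1 := by
  have := hξ.prob x
  exact measureReal_le_one

omit [Countable S] in
theorem IsMarkovChain.hitProb_anti (hξ : IsMarkovChain A P ξ) {H K : Set S} (h : H ⊆ K) (x y : S) :
    hitProb P ξ K x y ≤ hitProb P ξ H x y := by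
  have := hξ.prob x
  refine ENNReal.toReal_mono (measure_ne_top _ _) (measure_mono_ae ?_)
  filter_upwards [hξ.start x] with ω hω hK
  obtain ⟨τ, hτ, t, h1, h2, h3⟩ := (hitTime_lt_top_iff hξ.right_cont hω K y).1 hK
  exact (hitTime_lt_top_iff hξ.right_cont hω H y).2
    ⟨τ, hτ, t, h1, h2, fun u hu hu' a ha => h3 u hu hu' a (h ha)⟩

/-- A return probability of 1 would remain 1 with only `y` taboo. The decomposition at `x` itself
would then force the probability of reaching `y` before returning to `x` to vanish. -/
theorem IsMarkovChain.hitProb_return_lt_one (hA : IsConservativeQMatrix A)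
    (hξ : IsMarkovChain A P ξ) (hirr : IsIrreducible P ξ) (H : Set S) {x y : S} (hxy : x ≠ y) :
    hitProb P ξ (insert y H) x x < 1 := by
  refine lt_of_le_of_ne (hξ.hitProb_le_one _ _ _) fun h => ?_
  have h1 : hitProb P ξ (insert y ∅) x x = 1 := le_antisymm (hξ.hitProb_le_one _ _ _)
    (h.symm.le.trans (hξ.hitProb_anti (insert_subset_insert (empty_subset H)) x x))
  have h2 := hξ.hitProb_decomp (H := ∅) (x := x) hxy (notMem_empty x)
  rw [h1, one_mul, right_eq_add, insert_empty_eq] at h2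
  exact (hξ.hitProb_pos hA hirr hxy).ne' h2

/-- If both factors were 1, the two decompositions would make the return to `y` under taboo `H`
certain, although `H` contains a state other than `y`. -/
theorem IsMarkovChain.hitProb_cycle_lt_one (hA : IsConservativeQMatrix A)
    (hξ : IsMarkovChain A P ξ) (hirr : IsIrreducible P ξ) {H : Set S} {y z : S} (hH : H.Nonempty)
    (hy : y ∉ H) (hz : z ∉ H) (hzy : z ≠ y) : hitProb P ξ H y z * hitProb P ξ H z y < 1 := by
  have l1 := hξ.hitProb_le_one H y z
  have l2 := hξ.hitProb_le_one H z y
  have n1 : 0 ≤ hitProb P ξ H y z := measureReal_nonneg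
  have n2 : 0 ≤ hitProb P ξ H z y := measureReal_nonneg
  by_contra hge
  have e1 : hitProb P ξ H y z = 1 := by nlinarith
  have e2 : hitProb P ξ H z y = 1 := by nlinarith
  have d1 := hξ.hitProb_decomp (x := y) hzy hz
  have d2 := hξ.hitProb_decomp (x := y) hzy.symm hy
  rw [e2, mul_one] at d1
  rw [e1, mul_one] at d2
  obtain ⟨h, hh⟩ := hH
  have := hξ.hitProb_return_lt_one hA hirr H (x := y) (y := h) fun e => hy (e ▸ hh)
  rw [insert_eq_of_mem hh] at this
  linarith

omit [TopologicalSpace S] [DiscreteTopology S] in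
theorem hasSum_measureReal_iUnion {B : S → Set Ω} (μ : Measure Ω) [IsFiniteMeasure μ]
    (hB : ∀ w, MeasurableSet (B w)) (hd : Pairwise (Function.onFun Disjoint B)) :
    HasSum (fun w => μ.real (B w)) (μ.real (⋃ w, B w)) := by
  have h := measure_iUnion hd hB (μ := μ)
  have hne : ∑' w, μ (B w) ≠ ⊤ := h ▸ measure_ne_top _ _
  rw [measureReal_def, h, ENNReal.tsum_toReal_eq fun w => measure_ne_top _ _]
  exact ENNReal.hasSum_toReal hne

open Classical in
omit [TopologicalSpace S] [DiscreteTopology S] [Countable S] in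
theorem IsConservativeQMatrix.hasSum_jump (hA : IsConservativeQMatrix A) (x : S) :
    HasSum (fun w => if w = x then 0 else A x w / -A x x) 1 := by
  have h := ((hA.row_sum x).sub (hasSum_ite_eq x (A x x))).div_const (-A x x)
  rw [zero_sub, div_self (neg_pos.2 (hA.diag_neg x)).ne'] at h
  refine h.congr_fun fun w => ?_
  by_cases hw : w = x <;> simp [hw]

open Classical in
/-- Decomposition at the exit state. -/
theorem IsMarkovChain.hasSum_hitProb (hA : IsConservativeQMatrix A) (hξ : IsMarkovChain A P ξ)
    (H : Set S) (x y : S) :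
    HasSum (fun w => if w = x then 0 else A x w / -A x x *
      (if w = y then 1 else if w ∈ H then 0 else hitProb P ξ H w y)) (hitProb P ξ H x y) := by
  have := hξ.prob x
  obtain ⟨hδ, hpos⟩ := exists_mesh 1 one_pos
  have hdisj : ∀ Q : Ω → ℝ≥0 → Prop, Pairwise (Function.onFun Disjoint fun w : S =>
      {ω | ∃ τ, IsExit (fun t => ξ t ω) x τ ∧ ξ τ ω = w ∧ Q ω τ}) := by
    intro Q w w' hne
    rw [Function.onFun, Set.disjoint_left]
    rintro ω ⟨τ, hτ, hw, -⟩ ⟨σ, hσ, hw', -⟩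
    rw [hσ.unique hτ] at hw'
    exact hne (OnePoint.coe_injective (hw.symm.trans hw'))
  have hempty : ∀ Q : Ω → ℝ≥0 → Prop,
      {ω | ∃ τ, IsExit (fun t => ξ t ω) x τ ∧ ξ τ ω = x ∧ Q ω τ} = ∅ := fun Q =>
    eq_empty_of_forall_notMem fun ω ⟨τ, hτ, hx, _⟩ => hτ.2 hx
  have hall := fun (w : S) (hw : w ≠ x) => hξ.measure_exit_state hδ hpos hA hw
    (C := univ) .univ (Q := fun _ _ => True) (c := 1)
    (fun ω τ => Eventually.of_forall fun n => iff_of_true trivial trivial)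
    (tendsto_const_nhds.congr fun n => by
      have := (hξ.isGridChain ((1 : ℝ≥0) / (n + 1 : ℕ))).prob w
      exact probReal_univ.symm)
  have hhit := fun (w : S) (hw : w ≠ x) => hξ.measure_exit_state hδ hpos hA hw
    (measurableSet_avoidHit H y) (Q := fun ω τ => HitsFrom (fun t => ξ t ω) τ H y)
    (fun ω τ => eventually_shift_grid_avoidHit hδ hpos (hξ.right_cont ω) τ H y)
    (hξ.tendsto_avoidHit_start hδ hpos H w y)
  have hsum1 := hasSum_measureReal_iUnion (P x) (fun w => by
    by_cases hw : w = x
    · rw [hw, hempty]; exact .empty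
    · exact (hall w hw).1) (hdisj fun _ _ => True)
  have hsum2 := hasSum_measureReal_iUnion (P x) (fun w => by
    by_cases hw : w = x
    · rw [hw, hempty]; exact .empty
    · exact (hhit w hw).1) (hdisj fun ω τ => HitsFrom (fun t => ξ t ω) τ H y)
  -- Conservativity enters here: jump probabilities sum to 1, so almost surely the path leaves `x`,
  -- and does so into `S` rather than to `∞`.
  have hone : (P x).real (⋃ w : S, {ω | ∃ τ, IsExit (fun t => ξ t ω) x τ ∧ ξ τ ω = w ∧ True}) = 1 := by
    refine hsum1.unique ?_
    convert hA.hasSum_jump x using 2 with w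
    by_cases hw : w = x
    · rw [hw, hempty, measureReal_empty, if_pos rfl]
    · rw [if_neg hw, (hall w hw).2, mul_one]
  have hE : hitProb P ξ H x y = (P x).real (⋃ w : S, {ω | ∃ τ, IsExit (fun t => ξ t ω) x τ ∧
      ξ τ ω = w ∧ HitsFrom (fun t => ξ t ω) τ H y}) := by
    have hU : MeasurableSet (⋃ w : S,
        {ω | ∃ τ, IsExit (fun t => ξ t ω) x τ ∧ ξ τ ω = w ∧ True}) := .iUnion fun w => by
      by_cases hw : w = x
      · rw [hw, hempty]; exact .empty
      · exact (hall w hw).1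
    rw [measureReal_def, ENNReal.toReal_eq_one_iff, ← prob_compl_eq_zero_iff hU] at hone
    refine measureReal_congr ?_
    filter_upwards [hξ.start x, measure_eq_zero_iff_ae_notMem.1 hone] with ω hω hex
    refine propext ((hitTime_lt_top_iff hξ.right_cont hω H y).trans ?_)
    obtain ⟨w, τ, hτ, hw, -⟩ := mem_iUnion.1 (not_not.1 hex)
    refine ⟨fun ⟨σ, hσ, hh⟩ => mem_iUnion.2 ⟨w, σ, hσ, hσ.unique hτ ▸ hw, hh⟩, fun h => ?_⟩
    obtain ⟨w, τ, hτ, -, hh⟩ := mem_iUnion.1 h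
    exact ⟨τ, hτ, hh⟩
  rw [hE]
  convert hsum2 using 2 with w
  by_cases hw : w = x
  · rw [hw, hempty, measureReal_empty, if_pos rfl]
  · rw [if_neg hw, (hhit w hw).2]

end Identities

end TabooChain

theorem theorem2 {S Ω : Type*} [Countable S] [DecidableEq S]
    [TopologicalSpace S] [DiscreteTopology S] [MeasurableSpace Ω]
    (A : Matrix S S ℝ) (P : S → Measure Ω) (ξ : ℝ≥0 → Ω → OnePoint S)
    (hA : TabooChain.IsConservativeQMatrix A)
    (hξ : TabooChain.IsMarkovChain A P ξ)
    (hirr : TabooChain.IsIrreducible P ξ) :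
    (∀ (H : Set S) (x y z : S), H.Nonempty → y ∉ H → z ∉ H → z ≠ y →
      TabooChain.hitProb P ξ H y z * TabooChain.hitProb P ξ H z y < 1 ∧
      TabooChain.hitProb P ξ (insert z H) x y =
        (TabooChain.hitProb P ξ H x y
            - TabooChain.hitProb P ξ H x z * TabooChain.hitProb P ξ H z y) /
          (1 - TabooChain.hitProb P ξ H y z * TabooChain.hitProb P ξ H z y)) ∧
    (∀ (H : Set S) (x y : S), x ∉ H → x ≠ y →
      TabooChain.hitProb P ξ (insert y H) x x < 1 ∧
      TabooChain.hitProb P ξ H x y =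
        TabooChain.hitProb P ξ (insert x H) x y /
          (1 - TabooChain.hitProb P ξ (insert y H) x x)) ∧
    (∀ (H : Set S) (x y : S),
      Summable (fun z : {z : S // z ≠ x ∧ z ≠ y ∧ z ∉ H} =>
        A x z / A x x * TabooChain.hitProb P ξ H z y) ∧
      TabooChain.hitProb P ξ H x y =
        ((if x = y then (1 : ℝ) else 0) - 1) * (A x y / A x x)
          - ∑' z : {z : S // z ≠ x ∧ z ≠ y ∧ z ∉ H},
              A x z / A x x * TabooChain.hitProb P ξ H z y) := by
  refine ⟨fun H x y z hH hy hz hzy => ?_, fun H x y hx hxy => ?_, fun H x y => ?_⟩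
  · have hlt := hξ.hitProb_cycle_lt_one hA hirr hH hy hz hzy
    refine ⟨hlt, (eq_div_iff (sub_pos.2 hlt).ne').2 ?_⟩
    -- The terms containing F_{y,H}(x,z) cancel, leaving F_{z,H}(x,y) times the denominator.
    rw [hξ.hitProb_decomp (x := x) hzy hz, hξ.hitProb_decomp (x := x) hzy.symm hy]
    ring
  · have hlt := hξ.hitProb_return_lt_one hA hirr H hxy
    refine ⟨hlt, (eq_div_iff (sub_pos.2 hlt).ne').2 ?_⟩
    linear_combination hξ.hitProb_decomp (x := x) hxy hx
  -- The direct jump to `y` is split off; for `x = y` the subtracted term is 0, matching the missing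
  -- term at `w = x`.
  · have h := (hξ.hasSum_hitProb hA H x y).sub
      (hasSum_ite_eq y (((if x = y then (1 : ℝ) else 0) - 1) * (A x y / A x x)))
    have h' : HasSum (fun z : {z : S // z ≠ x ∧ z ≠ y ∧ z ∉ H} =>
        A x z / A x x * TabooChain.hitProb P ξ H z y)
        (-(TabooChain.hitProb P ξ H x y -
          ((if x = y then (1 : ℝ) else 0) - 1) * (A x y / A x x))) := by
      refine (hasSum_subtype_iff_indicator (s := {z : S | z ≠ x ∧ z ≠ y ∧ z ∉ H})
        (f := fun z => A x z / A x x * TabooChain.hitProb P ξ H z y)).2 ?_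
      refine h.neg.congr_fun fun w => ?_
      by_cases hwx : w = x
      · by_cases hxy : x = y <;> simp [hwx, hxy]
      · by_cases hwy : w = y
        · subst hwy
          simp [hwx, Ne.symm hwx, div_neg]
        · by_cases hwH : w ∈ H <;> simp [hwx, hwy, hwH, div_neg]
    refine ⟨h'.summable, ?_⟩
    rw [h'.tsum_eq]
    ring
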